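/- Let $a,b,c,d,e\in\mathbb{R}$ with $b\neq 0$ and let $\gamma\ge -1/2$. For $1\le p<\infty$ let $L^p_\gamma(\mathbb{R}_+)$ be the space of measurable functions $h:\mathbb{R}_+\to\mathbb{C}$ (modulo equality almost everywhere) with $$\|h\|_{\gamma,p}=\Big(\int_0^\infty |h(s)|^p\,s^{2\gamma+1}\,ds\Big)^{1/p}<\infty .$$ Let $$j_\gamma(x)=\Gamma(\gamma+1)\sum_{n=0}^{\infty}\frac{(-1)^n (x/2)^{2n}}{n!\,\Gamma(n+\gamma+1)},\qquad c_\gamma=\frac{1}{2^\gamma\,\Gamma(\gamma+1)},$$ and for $h\in L^1_\gamma(\mathbb{R}_+)$ define the quadratic-phase Fourier--Bessel transform of $h$ by $$\mathbb{B}^{a,b,c}_{d,e,\gamma}[h](t)=\frac{c_\gamma}{(ib)^{\gamma+1}}\int_0^\infty e^{-i(as^2+ct^2+ds+et)}\,j_\gamma\!\left(\frac{st}{b}\right)h(s)\,s^{2\gamma+1}\,ds ,$$ where $(ib)^{\gamma+1}$ is the principal value of the power. **Theorem.** If $h\in L^1_\gamma(\mathbb{R}_+)\cap L^2_\gamma(\mathbb{R}_+)$,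 then $\mathbb{B}^{a,b,c}_{d,e,\gamma}[h]\in L^2_\gamma(\mathbb{R}_+)$ and $$\big\|\mathbb{B}^{a,b,c}_{d,e,\gamma}[h]\big\|_{\gamma,2}=\|h\|_{\gamma,2}.$$ -/

import Mathlib

open MeasureTheory

namespace QPFB

/-- The normalized Bessel function
`j_γ(x) = Γ(γ+1) ∑_{n ≥ 0} (-1)^n (x/2)^{2n} / (n! Γ(n+γ+1))`, an even entire series in `x`. -/
noncomputable def normalizedBessel (γ x : ℝ) : ℝ :=
  Real.Gamma (γ + 1) *
    ∑' n : ℕ, (-1 : ℝ) ^ n * (x / 2) ^ (2 * n) / ((n.factorial : ℝ) * Real.Gamma ((n : ℝ) + γ + 1))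

/-- The constant `c_γ = 1 / (2^γ Γ(γ+1))`. -/
noncomputable def besselConst (γ : ℝ) : ℝ :=
  1 / ((2 : ℝ) ^ γ * Real.Gamma (γ + 1))

/-- The quadratic-phase Fourier--Bessel kernel
`𝕁(t,s) = exp(-i (a s² + c t² + d s + e t)) j_γ(s t / b)`. -/
noncomputable def kernel (a b c d e γ t s : ℝ) : ℂ :=
  Complex.exp (-Complex.I * ((a * s ^ 2 + c * t ^ 2 + d * s + e * t : ℝ) : ℂ)) *
    (normalizedBessel γ (s * t / b) : ℂ)

/-- The quadratic-phase Fourier--Bessel transform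
`𝔹[h](t) = c_γ / (i b)^{γ+1} ∫_0^∞ 𝕁(t,s) h(s) s^{2γ+1} ds`
(principal branch of the complex power). -/
noncomputable def transform (a b c d e γ : ℝ) (h : ℝ → ℂ) (t : ℝ) : ℂ :=
  (besselConst γ : ℂ) / (Complex.I * (b : ℂ)) ^ ((γ : ℂ) + 1) *
    ∫ s in Set.Ioi (0 : ℝ), kernel a b c d e γ t s * h s * ((s ^ (2 * γ + 1) : ℝ) : ℂ)

/-- The measure `s^{2γ+1} ds` on the half line `(0, ∞)`, as a measure on `ℝ`. The space `L^p_γ(ℝ₊)`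
is the `L^p` space of this measure: a function on the half line is represented by any of its
extensions to `ℝ`. -/
noncomputable def weightedMeasure (γ : ℝ) : Measure ℝ :=
  (volume.restrict (Set.Ioi (0 : ℝ))).withDensity fun s => ENNReal.ofReal (s ^ (2 * γ + 1))

end QPFB

namespace QPFB

open Real Filter Topology

/-- The Bessel–Clifford function `∑ₙ (-w)ⁿ / (n! Γ(n+γ+1))`. -/
noncomputable def besselClifford (γ w : ℝ) : ℝ :=
  ∑' n : ℕ, (-w) ^ n / ((n.factorial : ℝ) * Gamma ((n : ℝ) + γ + 1))

theorem Gamma_natCast_add_pos {γ : ℝ} (hγ : -1 < γ) (n : ℕ) : 0 < Gamma ((n : ℝ) + γ + 1) :=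
  Gamma_pos_of_pos (by have : (0 : ℝ) ≤ n := n.cast_nonneg; linarith)

theorem Gamma_natCast_succ_add {γ : ℝ} (hγ : -1 < γ) (n : ℕ) :
    Gamma (((n + 1 : ℕ) : ℝ) + γ + 1) = ((n : ℝ) + γ + 1) * Gamma ((n : ℝ) + γ + 1) := by
  have h0 : (0 : ℝ) ≤ n := n.cast_nonneg
  rw [← Gamma_add_one (by linarith)]
  push_cast
  ring_nf

theorem summable_besselClifford {γ : ℝ} (hγ : -1 < γ) (w : ℝ) :
    Summable fun n : ℕ => w ^ n / ((n.factorial : ℝ) * Gamma ((n : ℝ) + γ + 1)) := by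
  rcases eq_or_ne w 0 with rfl | hw
  · exact summable_of_ne_finset_zero (s := {0}) fun n hn => by
      simp only [Finset.mem_singleton] at hn
      simp [hn]
  refine summable_of_ratio_test_tendsto_lt_one (l := 0) one_pos (Eventually.of_forall fun n => ?_) ?_
  · have := Gamma_natCast_add_pos hγ n
    positivity
  · have h1 : Tendsto (fun n : ℕ => |w| / ((n : ℝ) + 1) * (1 / ((n : ℝ) + (γ + 1)))) atTop (𝓝 (0 * 0)) := by
      refine Tendsto.mul ?_ ?_
      · exact tendsto_const_nhds.div_atTop
          (tendsto_atTop_add_const_right _ _ tendsto_natCast_atTop_atTop)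
      · exact tendsto_const_nhds.div_atTop
          (tendsto_atTop_add_const_right _ _ tendsto_natCast_atTop_atTop)
    rw [mul_zero] at h1
    refine h1.congr fun n => ?_
    have hG := Gamma_natCast_add_pos hγ n
    have h0 : (0 : ℝ) ≤ n := n.cast_nonneg
    have hp : 0 < (n : ℝ) + γ + 1 := by linarith
    rw [Gamma_natCast_succ_add hγ, Nat.factorial_succ, ← norm_div, pow_succ]
    have : w ^ n * w / (((n + 1) * n.factorial : ℕ) * (((n : ℝ) + γ + 1) * Gamma ((n : ℝ) + γ + 1))) /
        (w ^ n / ((n.factorial : ℝ) * Gamma ((n : ℝ) + γ + 1))) =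
        w * (1 / ((n : ℝ) + 1) * (1 / ((n : ℝ) + (γ + 1)))) := by
      have : (n : ℝ) + (γ + 1) ≠ 0 := by linarith
      push_cast
      field_simp
      ring
    rw [this, norm_mul, norm_of_nonneg (r := _ * _), norm_eq_abs]
    · ring
    · have : 0 < (n : ℝ) + (γ + 1) := by linarith
      positivity

theorem besselClifford_zero (γ : ℝ) : besselClifford γ 0 = 1 / Gamma (γ + 1) := by
  rw [besselClifford, tsum_eq_single 0]
  · simp
  · intro n hn
    simp [hn]

theorem besselClifford_eq {γ : ℝ} (hγ : -1 < γ) (w : ℝ) :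
    besselClifford γ w = (γ + 1) * besselClifford (γ + 1) w - w * besselClifford (γ + 2) w := by
  have s0 := (summable_besselClifford hγ (-w)).hasSum
  have s1 := (summable_besselClifford (γ := γ + 1) (by linarith) (-w)).hasSum
  have s3 := ((s1.mul_left (γ + 1)).sub s0)
  have e := s3.tsum_eq
  rw [s3.summable.tsum_eq_zero_add] at e
  have e0 : (γ + 1) * ((-w) ^ 0 / (((0 : ℕ).factorial : ℝ) * Gamma (((0 : ℕ) : ℝ) + (γ + 1) + 1))) -
      (-w) ^ 0 / (((0 : ℕ).factorial : ℝ) * Gamma (((0 : ℕ) : ℝ) + γ + 1)) = 0 := by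
    have h1 := Gamma_natCast_succ_add hγ 0
    have h2 := Gamma_natCast_add_pos hγ 0
    have h3 : γ + 1 ≠ 0 := by linarith
    simp only [zero_add, Nat.cast_one, Nat.cast_zero] at h1 h2
    rw [add_comm 1 γ] at h1
    simp only [pow_zero, Nat.factorial_zero, Nat.cast_one, one_mul, Nat.cast_zero, zero_add, h1]
    field_simp
    simp
  rw [e0, zero_add] at e
  have e1 : w * besselClifford (γ + 2) w = ∑' n : ℕ, w * ((-w) ^ n /
      ((n.factorial : ℝ) * Gamma ((n : ℝ) + (γ + 2) + 1))) := by
    rw [tsum_mul_left, besselClifford]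
  have e2 : w * besselClifford (γ + 2) w =
      (γ + 1) * besselClifford (γ + 1) w - besselClifford γ w := by
    rw [e1]
    refine Eq.trans (tsum_congr fun n => ?_) e
    have h1 := Gamma_natCast_succ_add hγ (n + 1)
    have h2 := Gamma_natCast_add_pos hγ (n + 1)
    have h0 : (0 : ℝ) ≤ n := n.cast_nonneg
    have h3 : (n : ℝ) + 1 + γ + 1 ≠ 0 := by linarith
    push_cast at h1 h2
    rw [Nat.factorial_succ]
    push_cast
    rw [show (n : ℝ) + (γ + 2) + 1 = n + 1 + 1 + γ + 1 by ring,
      show (n : ℝ) + 1 + (γ + 1) + 1 = n + 1 + 1 + γ + 1 by ring, h1, pow_succ]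
    field_simp
    ring
  linarith

theorem hasDerivAt_besselClifford {γ : ℝ} (hγ : -1 < γ) (w : ℝ) :
    HasDerivAt (besselClifford γ) (-besselClifford (γ + 1) w) w := by
  set R := |w| + 1
  have hs : Summable fun n : ℕ =>
      (n : ℝ) * R ^ (n - 1) / ((n.factorial : ℝ) * Gamma ((n : ℝ) + γ + 1)) := by
    rw [← summable_nat_add_iff 1]
    refine (summable_besselClifford (γ := γ + 1) (by linarith) R).congr fun n => ?_
    rw [Nat.factorial_succ]
    push_cast
    have : (n : ℝ) + 1 ≠ 0 := by positivity
    rw [mul_assoc, mul_div_mul_left _ _ this]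
    ring_nf
  have bound : ∀ (n : ℕ) (y : ℝ), |y| < R →
      ‖-((n : ℝ) * (-y) ^ (n - 1)) / ((n.factorial : ℝ) * Gamma ((n : ℝ) + γ + 1))‖ ≤
        (n : ℝ) * R ^ (n - 1) / ((n.factorial : ℝ) * Gamma ((n : ℝ) + γ + 1)) := by
    intro n y hy
    have hG := Gamma_natCast_add_pos hγ n
    rw [norm_div, norm_neg, norm_mul, norm_pow, norm_neg, norm_eq_abs, norm_eq_abs, norm_eq_abs,
      Nat.abs_cast, abs_of_pos (a := _ * Gamma _) (by positivity)]
    gcongr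
  have hw : |w| < R := lt_add_one _
  have key := hasDerivAt_tsum_of_isPreconnected (𝕜 := ℝ) hs Metric.isOpen_ball
    (convex_ball (0 : ℝ) R).isPreconnected
    (g := fun (n : ℕ) w => (-w) ^ n / ((n.factorial : ℝ) * Gamma ((n : ℝ) + γ + 1)))
    (g' := fun (n : ℕ) w => -((n : ℝ) * (-w) ^ (n - 1)) / ((n.factorial : ℝ) * Gamma ((n : ℝ) + γ + 1)))
    (y₀ := 0) (y := w) (fun n y _ => ?_) (fun n y hy => bound n y (by simpa using hy))
    (by simp [R]; positivity)
    (by simpa using summable_besselClifford hγ 0) (by simp [R])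
  · have e : ∑' n : ℕ, -((n : ℝ) * (-w) ^ (n - 1)) / ((n.factorial : ℝ) * Gamma ((n : ℝ) + γ + 1)) =
        -besselClifford (γ + 1) w := by
      rw [(Summable.of_norm_bounded hs fun n => bound n w hw).tsum_eq_zero_add]
      simp only [CharP.cast_eq_zero, zero_mul, neg_zero, zero_div, zero_add, besselClifford]
      rw [← tsum_neg]
      refine tsum_congr fun n => ?_
      rw [Nat.factorial_succ]
      push_cast
      have : (n : ℝ) + 1 ≠ 0 := by positivity
      rw [← mul_neg, mul_assoc, mul_div_mul_left _ _ this]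
      ring_nf
    rw [e] at key
    exact key
  · exact (((hasDerivAt_neg y).fun_pow n).div_const _).congr_deriv (by ring)

theorem sq_besselClifford_le {γ : ℝ} (hγ : -(1 / 2) ≤ γ) {w : ℝ} (hw : 0 ≤ w) :
    besselClifford γ w ^ 2 ≤ besselClifford γ 0 ^ 2 := by
  have d0 := hasDerivAt_besselClifford (γ := γ) (by linarith)
  have d1 := hasDerivAt_besselClifford (γ := γ + 1) (by linarith)
  have d (w : ℝ) : HasDerivAt (fun w => besselClifford γ w ^ 2 + w * besselClifford (γ + 1) w ^ 2)
      (-(2 * γ + 1) * besselClifford (γ + 1) w ^ 2) w := by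
    refine (((d0 w).fun_pow 2).fun_add ((hasDerivAt_id w).fun_mul ((d1 w).fun_pow 2))).congr_deriv ?_
    have := besselClifford_eq (γ := γ) (by linarith) w
    rw [this, show γ + 1 + 1 = γ + 2 by ring]
    simp only [id]
    push_cast
    ring
  have anti : Antitone fun w => besselClifford γ w ^ 2 + w * besselClifford (γ + 1) w ^ 2 :=
    antitone_of_hasDerivAt_nonpos d fun w =>
      mul_nonpos_of_nonpos_of_nonneg (by linarith) (sq_nonneg _)
  have := anti hw
  simp only [zero_mul, add_zero] at this
  have h2 : 0 ≤ w * besselClifford (γ + 1) w ^ 2 := by positivity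
  linarith

theorem normalizedBessel_eq (γ x : ℝ) :
    normalizedBessel γ x = Gamma (γ + 1) * besselClifford γ ((x / 2) ^ 2) := by
  rw [normalizedBessel, besselClifford]
  congr 1
  refine tsum_congr fun n => ?_
  rw [neg_pow ((x / 2) ^ 2), pow_mul]

theorem continuous_normalizedBessel {γ : ℝ} (hγ : -1 < γ) : Continuous (normalizedBessel γ) := by
  have h : Continuous (besselClifford γ) :=
    continuous_iff_continuousAt.2 fun w => (hasDerivAt_besselClifford hγ w).continuousAt
  rw [funext (normalizedBessel_eq γ)]
  fun_prop

theorem abs_normalizedBessel_le_one {γ : ℝ} (hγ : -(1 / 2) ≤ γ) (x : ℝ) :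
    |normalizedBessel γ x| ≤ 1 := by
  have hG : 0 < Gamma (γ + 1) := Gamma_pos_of_pos (by linarith)
  rw [← sq_le_one_iff_abs_le_one, normalizedBessel_eq, mul_pow]
  calc _ ≤ Gamma (γ + 1) ^ 2 * besselClifford γ 0 ^ 2 := by
        refine mul_le_mul_of_nonneg_left ?_ (sq_nonneg _)
        exact sq_besselClifford_le hγ (sq_nonneg _)
    _ = 1 := by
        rw [besselClifford_zero]
        field_simp

theorem ae_weightedMeasure_pos (γ : ℝ) : ∀ᵐ s ∂weightedMeasure γ, 0 < s :=
  (withDensity_absolutelyContinuous _ _).ae_le (ae_restrict_mem measurableSet_Ioi)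

instance (γ : ℝ) : SFinite (weightedMeasure γ) := by
  unfold weightedMeasure
  infer_instance

theorem integral_weightedMeasure {E : Type*} [NormedAddCommGroup E] [NormedSpace ℝ E] (γ : ℝ)
    (f : ℝ → E) :
    ∫ s, f s ∂weightedMeasure γ = ∫ s in Set.Ioi 0, (s ^ (2 * γ + 1) : ℝ) • f s := by
  rw [weightedMeasure, integral_withDensity_eq_integral_toReal_smul (by fun_prop) (by simp)]
  refine setIntegral_congr_fun measurableSet_Ioi fun s hs => ?_
  simp only [ENNReal.toReal_ofReal (rpow_nonneg (le_of_lt hs) _)]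

theorem integrable_weightedMeasure_iff {E : Type*} [NormedAddCommGroup E] [NormedSpace ℝ E] (γ : ℝ)
    (f : ℝ → E) : Integrable f (weightedMeasure γ) ↔
      IntegrableOn (fun s => (s ^ (2 * γ + 1) : ℝ) • f s) (Set.Ioi 0) := by
  rw [weightedMeasure, integrable_withDensity_iff_integrable_smul' (by fun_prop) (by simp)]
  refine integrableOn_congr_fun (fun s hs => ?_) measurableSet_Ioi
  simp only [ENNReal.toReal_ofReal (rpow_nonneg (le_of_lt (Set.mem_Ioi.1 hs)) _)]

theorem gaussian_moment {γ α : ℝ} (hγ : -1 < γ) (hα : 0 < α) (n : ℕ) :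
    Integrable (fun s : ℝ => s ^ (2 * n) * exp (-α * s ^ 2)) (weightedMeasure γ) ∧
    ∫ s : ℝ, s ^ (2 * n) * exp (-α * s ^ 2) ∂weightedMeasure γ =
      Gamma (n + γ + 1) / (2 * α ^ (n + γ + 1)) := by
  have h0 : (0 : ℝ) ≤ n := n.cast_nonneg
  have e : Set.EqOn (fun s : ℝ => s ^ (2 * n + (2 * γ + 1)) * exp (-α * s ^ (2 : ℝ)))
      (fun s : ℝ => (s ^ (2 * γ + 1) : ℝ) • (s ^ (2 * n) * exp (-α * s ^ 2))) (Set.Ioi 0) := by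
    intro s hs
    simp only [smul_eq_mul]
    rw [rpow_add hs, rpow_two, ← mul_assoc, mul_comm (s ^ (2 * γ + 1))]
    congr 2
    exact_mod_cast rpow_natCast s (2 * n)
  constructor
  · rw [integrable_weightedMeasure_iff, ← integrableOn_congr_fun e measurableSet_Ioi]
    exact integrableOn_rpow_mul_exp_neg_mul_rpow (by linarith) two_pos hα
  · rw [integral_weightedMeasure, ← setIntegral_congr_fun measurableSet_Ioi e,
      integral_rpow_mul_exp_neg_mul_rpow two_pos (by linarith) hα,
      show (2 * (n : ℝ) + (2 * γ + 1) + 1) / 2 = n + γ + 1 by ring,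
      show -(2 * (n : ℝ) + (2 * γ + 1) + 1) / 2 = -(n + γ + 1) by ring, rpow_neg hα.le]
    field_simp

theorem integrable_gaussian {γ α : ℝ} (hγ : -1 < γ) (hα : 0 < α) :
    Integrable (fun s : ℝ => exp (-α * s ^ 2)) (weightedMeasure γ) := by
  simpa using (gaussian_moment hγ hα 0).1

theorem integral_gaussian_weightedMeasure {γ α : ℝ} (hγ : -1 < γ) (hα : 0 < α) :
    ∫ s : ℝ, exp (-α * s ^ 2) ∂weightedMeasure γ = Gamma (γ + 1) / (2 * α ^ (γ + 1)) := by
  simpa using (gaussian_moment hγ hα 0).2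

theorem integral_gaussian_mul_normalizedBessel {γ α : ℝ} (hγ : -1 < γ) (hα : 0 < α) (t : ℝ) :
    ∫ s, exp (-α * s ^ 2) * normalizedBessel γ (s * t) ∂weightedMeasure γ =
      Gamma (γ + 1) / (2 * α ^ (γ + 1)) * exp (-(t ^ 2 / (4 * α))) := by
  set κ : ℕ → ℝ := fun n => (-1) ^ n * (t ^ 2 / 4) ^ n / (n.factorial * Gamma (n + γ + 1))
  have hF (n : ℕ) : Integrable (fun s : ℝ => κ n * (s ^ (2 * n) * exp (-α * s ^ 2)))
      (weightedMeasure γ) := (gaussian_moment hγ hα n).1.const_mul _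
  have hval (n : ℕ) (x : ℝ) : x / (n.factorial * Gamma (n + γ + 1)) *
      (Gamma (n + γ + 1) / (2 * α ^ (n + γ + 1))) =
      1 / (2 * α ^ (γ + 1)) * (x / α ^ n / n.factorial) := by
    have := Gamma_natCast_add_pos hγ n
    rw [add_assoc (n : ℝ), rpow_add hα, rpow_natCast]
    rw [add_assoc] at this
    field_simp
  have hsum : Summable fun n => ∫ s : ℝ, ‖κ n * (s ^ (2 * n) * exp (-α * s ^ 2))‖ ∂weightedMeasure γ := by
    have : ∀ n, ∫ s : ℝ, ‖κ n * (s ^ (2 * n) * exp (-α * s ^ 2))‖ ∂weightedMeasure γ =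
        1 / (2 * α ^ (γ + 1)) * ((t ^ 2 / (4 * α)) ^ n / n.factorial) := by
      intro n
      have hG := Gamma_natCast_add_pos hγ n
      have e (s : ℝ) : ‖κ n * (s ^ (2 * n) * exp (-α * s ^ 2))‖ =
          (t ^ 2 / 4) ^ n / (n.factorial * Gamma (n + γ + 1)) * (s ^ (2 * n) * exp (-α * s ^ 2)) := by
        rw [norm_mul, norm_of_nonneg (r := _ * exp _)
          (mul_nonneg ((even_two_mul n).pow_nonneg s) (exp_pos _).le)]
        congr 1
        simp only [κ]
        rw [norm_div, norm_mul, norm_pow, norm_neg, norm_one, one_pow, one_mul,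
          norm_of_nonneg (by positivity), norm_of_nonneg (by positivity)]
      simp only [e]
      rw [integral_const_mul, (gaussian_moment hγ hα n).2, hval, ← div_pow, div_div]
    simp only [this]
    exact (summable_pow_div_factorial _).mul_left _
  have key := hasSum_integral_of_summable_integral_norm hF hsum
  have e1 (s : ℝ) : exp (-α * s ^ 2) * normalizedBessel γ (s * t) =
      Gamma (γ + 1) * ∑' n, κ n * (s ^ (2 * n) * exp (-α * s ^ 2)) := by
    rw [normalizedBessel, mul_left_comm, ← tsum_mul_left]
    congr 1
    refine tsum_congr fun n => ?_
    simp only [κ]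
    rw [pow_mul, pow_mul, show (s * t / 2) ^ 2 = s ^ 2 * (t ^ 2 / 4) by ring, mul_pow]
    ring
  simp only [e1]
  rw [integral_const_mul, ← key.tsum_eq]
  have e2 (n : ℕ) : ∫ s : ℝ, κ n * (s ^ (2 * n) * exp (-α * s ^ 2)) ∂weightedMeasure γ =
      1 / (2 * α ^ (γ + 1)) * ((-(t ^ 2 / (4 * α))) ^ n / n.factorial) := by
    rw [integral_const_mul, (gaussian_moment hγ hα n).2, hval, ← mul_pow, ← div_pow]
    congr 3
    field_simp
  simp only [e2]
  rw [tsum_mul_left, exp_eq_exp_ℝ, NormedSpace.exp_eq_tsum_div]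
  ring

/-- A bounded random variable whose powers are all orthogonal to an integrable density `ψ` is
orthogonal to `ψ` on all of its level sets. -/
theorem setIntegral_preimage_eq_zero_of_moments {α : Type*} [MeasurableSpace α] {μ : Measure α}
    {ψ : α → ℝ} (hψ : Integrable ψ μ) {X : α → ℝ} (hX : Measurable X)
    (hX1 : ∀ a, X a ∈ Set.Icc (0 : ℝ) 1) (hm : ∀ n : ℕ, ∫ a, X a ^ n * ψ a ∂μ = 0)
    {A : Set ℝ} (hA : MeasurableSet A) : ∫ a in X ⁻¹' A, ψ a ∂μ = 0 := by
  have hpoly (p : Polynomial ℝ) : Integrable (fun a => p.eval (X a) * ψ a) μ ∧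
      ∫ a, p.eval (X a) * ψ a ∂μ = 0 := by
    induction p using Polynomial.induction_on' with
    | add p q hp hq =>
      simp only [Polynomial.eval_add, add_mul]
      exact ⟨hp.1.add hq.1, by rw [integral_add hp.1 hq.1, hp.2, hq.2, add_zero]⟩
    | monomial n c =>
      simp only [Polynomial.eval_monomial, mul_assoc]
      refine ⟨Integrable.const_mul (hψ.bdd_mul (c := 1) (by fun_prop) ?_) _, ?_⟩
      · refine Filter.Eventually.of_forall fun a => ?_
        rw [norm_of_nonneg (pow_nonneg (hX1 a).1 n)]
        exact pow_le_one₀ (hX1 a).1 (hX1 a).2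
      · rw [integral_const_mul, hm, mul_zero]
  have hcont (g : BoundedContinuousFunction ℝ ℝ) : ∫ a, g (X a) * ψ a ∂μ = 0 := by
    have hg : Integrable (fun a => g (X a) * ψ a) μ :=
      hψ.bdd_mul (c := ‖g‖) (by fun_prop) (Filter.Eventually.of_forall fun a => g.norm_coe_le_norm _)
    rw [← norm_le_zero_iff]
    refine le_of_forall_pos_le_add fun ε hε => ?_
    set M := ∫ a, ‖ψ a‖ ∂μ
    have hM : 0 ≤ M := integral_nonneg fun _ => norm_nonneg _
    obtain ⟨p, hp⟩ := exists_polynomial_near_of_continuousOn 0 1 g g.continuous.continuousOn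
      (ε / (M + 1)) (by positivity)
    calc ‖∫ a, g (X a) * ψ a ∂μ‖ = ‖∫ a, (g (X a) * ψ a - p.eval (X a) * ψ a) ∂μ‖ := by
          rw [integral_sub hg (hpoly p).1, (hpoly p).2, sub_zero]
      _ ≤ ∫ a, ε / (M + 1) * ‖ψ a‖ ∂μ := by
          refine norm_integral_le_of_norm_le (hψ.norm.const_mul _) (Filter.Eventually.of_forall fun a => ?_)
          rw [← sub_mul, norm_mul, norm_sub_rev]
          exact mul_le_mul_of_nonneg_right (hp _ (hX1 a)).le (norm_nonneg _)
      _ = ε * (M / (M + 1)) := by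
          rw [integral_const_mul]
          ring
      _ ≤ 0 + ε := by
          rw [zero_add]
          exact mul_le_of_le_one_right hε.le ((div_le_one (by positivity)).2 (by linarith))
  set P := μ.withDensity fun a => ENNReal.ofReal (ψ a)
  set N := μ.withDensity fun a => ENNReal.ofReal (-ψ a)
  have hfin (φ : α → ℝ) (hφ : Integrable φ μ) :
      IsFiniteMeasure (μ.withDensity fun a => ENNReal.ofReal (φ a)) :=
    isFiniteMeasure_withDensity_ofReal hφ.2
  have : IsFiniteMeasure P := hfin _ hψ
  have : IsFiniteMeasure N := hfin _ hψ.neg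
  have hint (φ : α → ℝ) (hφ : Integrable φ μ) (g : BoundedContinuousFunction ℝ ℝ) :
      ∫ a, g (X a) ∂(μ.withDensity fun a => ENNReal.ofReal (φ a)) =
        ∫ a, g (X a) * max (φ a) 0 ∂μ := by
    rw [integral_withDensity_eq_integral_toReal_smul₀ hφ.aemeasurable.ennreal_ofReal (by simp)]
    simp only [ENNReal.toReal_ofReal', smul_eq_mul, mul_comm]
  have hPN : P.map X = N.map X := by
    refine ext_of_forall_integral_eq_of_IsFiniteMeasure fun g => ?_
    have hg (φ : α → ℝ) (hφ : Integrable φ μ) : Integrable (fun a => g (X a) * max (φ a) 0) μ :=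
      hφ.pos_part.bdd_mul (c := ‖g‖) (by fun_prop)
        (Filter.Eventually.of_forall fun a => g.norm_coe_le_norm _)
    rw [integral_map hX.aemeasurable (by fun_prop), integral_map hX.aemeasurable (by fun_prop),
      hint _ hψ, hint (fun a => -ψ a) hψ.neg, ← sub_eq_zero, ← integral_sub (hg _ hψ) (hg (fun a => -ψ a) hψ.neg)]
    refine (integral_congr_ae (Filter.Eventually.of_forall fun a => ?_)).trans (hcont g)
    simp only [← mul_sub]
    rw [max_zero_sub_max_neg_zero_eq_self]
  have hS := hX hA
  have hPA : P (X ⁻¹' A) = N (X ⁻¹' A) := by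
    rw [← Measure.map_apply hX hA, hPN, Measure.map_apply hX hA]
  rw [integral_eq_lintegral_pos_part_sub_lintegral_neg_part hψ.integrableOn,
    ← withDensity_apply _ hS, ← withDensity_apply _ hS]
  exact sub_eq_zero.2 (congrArg ENNReal.toReal hPA)

/-- The Gaussians `exp (-α t ^ 2)`, `α > 0`, form a total family on the half line. -/
theorem ae_eq_zero_of_integral_gaussian_eq_zero {μ : Measure ℝ} (hμ : ∀ᵐ t ∂μ, 0 < t) {φ : ℝ → ℝ}
    (hφ : ∀ α : ℝ, 0 < α → Integrable (fun t => exp (-α * t ^ 2) * φ t) μ)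
    (h0 : ∀ α : ℝ, 0 < α → ∫ t, exp (-α * t ^ 2) * φ t ∂μ = 0) : φ =ᵐ[μ] 0 := by
  have key := (hφ 1 one_pos).ae_eq_zero_of_forall_setIntegral_eq_zero fun S hS _ => by
    have h := setIntegral_preimage_eq_zero_of_moments (hφ 1 one_pos)
      (X := fun t => exp (-t ^ 2)) (by fun_prop)
      (fun t => ⟨(exp_pos _).le, exp_le_one_iff.2 (neg_nonpos.2 (sq_nonneg t))⟩) (fun n => by
        rw [← h0 (n + 1) (by positivity)]
        refine integral_congr_ae (Filter.Eventually.of_forall fun t => ?_)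
        simp only
        rw [← mul_assoc, ← exp_nat_mul, ← exp_add]
        ring_nf)
      (A := (fun x => √(-log x)) ⁻¹' S) (measurableSet_preimage (by fun_prop) hS)
    rw [← h]
    refine setIntegral_congr_set ?_
    filter_upwards [hμ] with t ht
    have : √(-log (exp (-t ^ 2))) = t := by rw [log_exp, neg_neg, sqrt_sq ht.le]
    change (t ∈ S) = (√(-log (exp (-t ^ 2))) ∈ S)
    rw [this]
  filter_upwards [key] with t ht
  simpa [(exp_pos _).ne'] using ht

theorem ae_eq_zero_of_integral_gaussian_eq_zero_complex {μ : Measure ℝ} (hμ : ∀ᵐ t ∂μ, 0 < t)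
    {φ : ℝ → ℂ} (hφ : ∀ α : ℝ, 0 < α → Integrable (fun t => (exp (-α * t ^ 2) : ℂ) * φ t) μ)
    (h0 : ∀ α : ℝ, 0 < α → ∫ t, (exp (-α * t ^ 2) : ℂ) * φ t ∂μ = 0) : φ =ᵐ[μ] 0 := by
  have hre := ae_eq_zero_of_integral_gaussian_eq_zero hμ (φ := fun t => (φ t).re)
    (fun α hα => by
      simpa only [RCLike.re_eq_complex_re, Complex.re_ofReal_mul] using (hφ α hα).re) (fun α hα => by
      have := congrArg Complex.re (h0 α hα)
      rw [← RCLike.re_eq_complex_re, ← integral_re (hφ α hα)] at this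
      simpa only [RCLike.re_eq_complex_re, Complex.re_ofReal_mul, Complex.zero_re] using this)
  have him := ae_eq_zero_of_integral_gaussian_eq_zero hμ (φ := fun t => (φ t).im)
    (fun α hα => by
      simpa only [RCLike.im_eq_complex_im, Complex.im_ofReal_mul] using (hφ α hα).im) (fun α hα => by
      have := congrArg Complex.im (h0 α hα)
      rw [← RCLike.im_eq_complex_im, ← integral_im (hφ α hα)] at this
      simpa only [RCLike.im_eq_complex_im, Complex.im_ofReal_mul, Complex.zero_im] using this)
  filter_upwards [hre, him] with t h1 h2
  exact Complex.ext h1 h2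

/-- Two families with equal Gram matrices and symmetric mixed products: if the first is total, then
`e i ↦ u i` extends to an isometry that is symmetric against the first family. -/
theorem exists_isometric_image {ι E : Type*} [NormedAddCommGroup E] [InnerProductSpace ℂ E]
    [CompleteSpace E] {e u : ι → E} (he : (Submodule.span ℂ (Set.range e))ᗮ = ⊥)
    (hu : ∀ i j, inner ℂ (e i) (e j) = inner ℂ (u i) (u j))
    (hs : ∀ i j, inner ℂ (e i) (u j) = inner ℂ (u i) (e j)) (f : E) :
    ∃ F : E, ‖F‖ = ‖f‖ ∧ ∀ i, inner ℂ (e i) F = inner ℂ (u i) f := by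
  set A := Finsupp.linearCombination ℂ e
  set B := Finsupp.linearCombination ℂ u
  have hd : DenseRange A := by
    rw [DenseRange, ← LinearMap.coe_range, Finsupp.range_linearCombination,
      Submodule.dense_iff_topologicalClosure_eq_top, Submodule.topologicalClosure_eq_top_iff, he]
  have hn (c : ι →₀ ℂ) : ‖B c‖ = ‖A c‖ := by
    have : inner ℂ (B c) (B c) = inner ℂ (A c) (A c) := by
      simp only [A, B, Finsupp.linearCombination_apply, Finsupp.sum_inner, Finsupp.inner_sum,
        inner_smul_left, inner_smul_right, hu]
    rw [← sq_eq_sq₀ (norm_nonneg _) (norm_nonneg _)]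
    rw [inner_self_eq_norm_sq_to_K, inner_self_eq_norm_sq_to_K] at this
    exact_mod_cast this
  set T := B.extendOfNorm A
  have hT (c : ι →₀ ℂ) : T (A c) = B c :=
    LinearMap.extendOfNorm_eq hd ⟨1, fun c => by rw [one_mul, hn]⟩ c
  refine ⟨T f, ?_, fun i => ?_⟩
  · refine hd.induction_on (p := fun f => ‖T f‖ = ‖f‖) f
      (isClosed_eq (by fun_prop) (by fun_prop)) fun c => ?_
    rw [hT, hn]
  · refine hd.induction_on (p := fun f => inner ℂ (e i) (T f) = inner ℂ (u i) f) f
      (isClosed_eq (by fun_prop) (by fun_prop)) fun c => ?_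
    rw [hT]
    simp only [A, B, Finsupp.linearCombination_apply, Finsupp.inner_sum, inner_smul_right, hs]

theorem memLp_gaussian {γ α : ℝ} (hγ : -1 < γ) (hα : 0 < α) :
    MemLp (fun t : ℝ => (exp (-α * t ^ 2) : ℂ)) 2 (weightedMeasure γ) := by
  rw [memLp_two_iff_integrable_sq_norm (by fun_prop)]
  refine (integrable_gaussian hγ (α := 2 * α) (by positivity)).congr
    (Filter.Eventually.of_forall fun t => ?_)
  simp only [Complex.norm_real, norm_eq_abs, abs_exp]
  rw [← exp_nat_mul]
  push_cast
  ring_nf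

/-- The Gaussian `exp (-α t ^ 2)` as an element of `L²` of the weighted measure. -/
noncomputable def gaussianLp {γ : ℝ} (hγ : -1 < γ) (α : Set.Ioi (0 : ℝ)) :
    Lp ℂ 2 (weightedMeasure γ) :=
  (memLp_gaussian hγ α.2).toLp _

theorem inner_gaussianLp {γ : ℝ} (hγ : -1 < γ) (α : Set.Ioi (0 : ℝ))
    (F : Lp ℂ 2 (weightedMeasure γ)) :
    inner ℂ (gaussianLp hγ α) F = ∫ t, (exp (-α * t ^ 2) : ℂ) * F t ∂weightedMeasure γ := by
  rw [L2.inner_def]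
  refine integral_congr_ae ?_
  filter_upwards [(memLp_gaussian hγ α.2).coeFn_toLp] with t ht
  rw [gaussianLp, ht, RCLike.inner_apply', Complex.conj_ofReal]

theorem inner_gaussianLp_gaussianLp {γ : ℝ} (hγ : -1 < γ) (α β : Set.Ioi (0 : ℝ)) :
    inner ℂ (gaussianLp hγ α) (gaussianLp hγ β) =
      ((Gamma (γ + 1) / 2 * ((α : ℝ) + β) ^ (-(γ + 1)) : ℝ) : ℂ) := by
  have h0 : (0 : ℝ) < (α : ℝ) + β := add_pos α.2 β.2
  rw [inner_gaussianLp, rpow_neg h0.le, ← div_eq_mul_inv, div_div,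
    ← integral_gaussian_weightedMeasure hγ h0, ← integral_complex_ofReal]
  refine integral_congr_ae ?_
  filter_upwards [(memLp_gaussian hγ β.2).coeFn_toLp] with t ht
  rw [gaussianLp, ht, ← Complex.ofReal_mul, ← exp_add]
  ring_nf

theorem orthogonal_span_gaussianLp {γ : ℝ} (hγ : -1 < γ) :
    (Submodule.span ℂ (Set.range (gaussianLp hγ)))ᗮ = ⊥ := by
  rw [Submodule.eq_bot_iff]
  intro F hF
  rw [Lp.eq_zero_iff_ae_eq_zero]
  refine ae_eq_zero_of_integral_gaussian_eq_zero_complex (ae_weightedMeasure_pos γ)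
    (fun α hα => (memLp_gaussian hγ hα).integrable_mul (Lp.memLp F)) fun α hα => ?_
  rw [← inner_gaussianLp hγ ⟨α, hα⟩ F]
  exact (Submodule.mem_orthogonal _ _).1 hF _ (Submodule.subset_span ⟨_, rfl⟩)

/-- The Hankel transform `f ↦ c_γ |b|^{-(γ+1)} ∫ j_γ(st/b) f(s) s^{2γ+1} ds`. -/
noncomputable def hankel (γ b : ℝ) (f : ℝ → ℂ) (t : ℝ) : ℂ :=
  ((besselConst γ / |b| ^ (γ + 1) : ℝ) : ℂ) *
    ∫ s, (normalizedBessel γ (s * t / b) : ℂ) * f s ∂weightedMeasure γ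

theorem aestronglyMeasurable_hankel {γ : ℝ} (hγ : -1 < γ) (b : ℝ) {f : ℝ → ℂ}
    (hf : Integrable f (weightedMeasure γ)) :
    AEStronglyMeasurable (hankel γ b f) (weightedMeasure γ) := by
  refine AEStronglyMeasurable.const_mul ?_ _
  refine AEStronglyMeasurable.integral_prod_right'
    (f := fun p : ℝ × ℝ => (normalizedBessel γ (p.2 * p.1 / b) : ℂ) * f p.2) ?_
  have := continuous_normalizedBessel hγ
  exact (Continuous.aestronglyMeasurable (by fun_prop)).mul hf.aestronglyMeasurable.comp_snd

theorem norm_hankel_le {γ : ℝ} (hγ : -(1 / 2) ≤ γ) (b : ℝ) {f : ℝ → ℂ}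
    (hf : Integrable f (weightedMeasure γ)) (t : ℝ) :
    ‖hankel γ b f t‖ ≤ ‖((besselConst γ / |b| ^ (γ + 1) : ℝ) : ℂ)‖ *
      ∫ s, ‖f s‖ ∂weightedMeasure γ := by
  rw [hankel, norm_mul]
  refine mul_le_mul_of_nonneg_left ?_ (norm_nonneg _)
  refine norm_integral_le_of_norm_le hf.norm (Filter.Eventually.of_forall fun s => ?_)
  rw [norm_mul, Complex.norm_real]
  exact mul_le_of_le_one_left (norm_nonneg _) (abs_normalizedBessel_le_one hγ _)

/-- The index of the Gaussian that is proportional to the Hankel transform of `exp (-α s ^ 2)`. -/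
noncomputable def dualIndex {b : ℝ} (hb : b ≠ 0) (α : Set.Ioi (0 : ℝ)) : Set.Ioi (0 : ℝ) :=
  ⟨1 / (4 * α * b ^ 2), by have := α.2.out; rw [Set.mem_Ioi]; positivity⟩

/-- The Hankel transform of `exp (-α s ^ 2)` as an element of `L²`. -/
noncomputable def hankelGaussianLp {γ b : ℝ} (hγ : -1 < γ) (hb : b ≠ 0) (α : Set.Ioi (0 : ℝ)) :
    Lp ℂ 2 (weightedMeasure γ) :=
  (((2 * α * |b|) ^ (-(γ + 1)) : ℝ) : ℂ) • gaussianLp hγ (dualIndex hb α)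

theorem integral_gaussian_mul_hankel {γ b : ℝ} (hγ : -(1 / 2) ≤ γ) (hb : b ≠ 0)
    (α : Set.Ioi (0 : ℝ)) {f : ℝ → ℂ} (hf : Integrable f (weightedMeasure γ)) :
    ∫ t, (exp (-α * t ^ 2) : ℂ) * hankel γ b f t ∂weightedMeasure γ =
      ∫ s, (((2 * α * |b|) ^ (-(γ + 1)) : ℝ) : ℂ) *
        ((exp (-(dualIndex hb α) * s ^ 2) : ℂ) * f s) ∂weightedMeasure γ := by
  have hγ1 : -1 < γ := by linarith
  have hα : (0 : ℝ) < α := α.2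
  have hb' : 0 < |b| := abs_pos.2 hb
  have hj := continuous_normalizedBessel hγ1
  set C : ℂ := ((besselConst γ / |b| ^ (γ + 1) : ℝ) : ℂ)
  have hint : Integrable (Function.uncurry fun t s : ℝ =>
      (normalizedBessel γ (s * t / b) : ℂ) * ((exp (-α * t ^ 2) : ℂ) * f s))
      ((weightedMeasure γ).prod (weightedMeasure γ)) := by
    refine Integrable.bdd_mul (c := 1) ((integrable_gaussian hγ1 hα).ofReal.mul_prod hf)
      (Continuous.aestronglyMeasurable (by fun_prop)) (Filter.Eventually.of_forall fun p => ?_)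
    rw [Complex.norm_real]
    exact abs_normalizedBessel_le_one hγ _
  calc _ = ∫ t, C * ∫ s, (normalizedBessel γ (s * t / b) : ℂ) * ((exp (-α * t ^ 2) : ℂ) * f s)
        ∂weightedMeasure γ ∂weightedMeasure γ := by
        refine integral_congr_ae (Filter.Eventually.of_forall fun t => ?_)
        simp only [hankel, mul_left_comm (normalizedBessel _ _ : ℂ)]
        rw [integral_const_mul, mul_left_comm]
    _ = C * ∫ s, ∫ t, (normalizedBessel γ (s * t / b) : ℂ) * ((exp (-α * t ^ 2) : ℂ) * f s)
        ∂weightedMeasure γ ∂weightedMeasure γ := by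
        rw [integral_const_mul, integral_integral_swap hint]
    _ = _ := by
        rw [← integral_const_mul]
        refine integral_congr_ae (Filter.Eventually.of_forall fun s => ?_)
        have e (t : ℝ) : (normalizedBessel γ (s * t / b) : ℂ) * ((exp (-α * t ^ 2) : ℂ) * f s) =
            ((exp (-α * t ^ 2) * normalizedBessel γ (t * (s / b)) : ℝ) : ℂ) * f s := by
          rw [show s * t / b = t * (s / b) by ring]
          push_cast
          ring
        simp only [e]
        rw [integral_mul_const, integral_complex_ofReal,
          integral_gaussian_mul_normalizedBessel hγ1 hα, ← mul_assoc, ← mul_assoc,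
          ← Complex.ofReal_mul, ← Complex.ofReal_mul, ← mul_assoc]
        have hG : Gamma (γ + 1) ≠ 0 := (Gamma_pos_of_pos (by linarith)).ne'
        congr 3
        · rw [besselConst, rpow_neg (by positivity), mul_rpow (by positivity) hb'.le,
            mul_rpow two_pos.le hα.le, rpow_add_one two_ne_zero γ]
          field_simp
        · simp only [dualIndex]
          field_simp

theorem inner_hankelGaussianLp {γ b : ℝ} (hγ : -1 < γ) (hb : b ≠ 0) (α : Set.Ioi (0 : ℝ))
    (F : Lp ℂ 2 (weightedMeasure γ)) :
    inner ℂ (hankelGaussianLp hγ hb α) F = ∫ s, (((2 * α * |b|) ^ (-(γ + 1)) : ℝ) : ℂ) *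
        ((exp (-(dualIndex hb α) * s ^ 2) : ℂ) * F s) ∂weightedMeasure γ := by
  rw [hankelGaussianLp, inner_smul_left, Complex.conj_ofReal, inner_gaussianLp, integral_const_mul]

theorem inner_hankelGaussianLp_hankelGaussianLp {γ b : ℝ} (hγ : -1 < γ) (hb : b ≠ 0)
    (α β : Set.Ioi (0 : ℝ)) : inner ℂ (gaussianLp hγ α) (gaussianLp hγ β) =
      inner ℂ (hankelGaussianLp hγ hb α) (hankelGaussianLp hγ hb β) := by
  have hα : (0 : ℝ) < α := α.2
  have hβ : (0 : ℝ) < β := β.2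
  have hb' : 0 < |b| := abs_pos.2 hb
  simp only [hankelGaussianLp, inner_smul_left, inner_smul_right, Complex.conj_ofReal,
    inner_gaussianLp_gaussianLp, ← Complex.ofReal_mul, dualIndex]
  have key : ((α : ℝ) + β) ^ (-(γ + 1)) = (2 * α * |b|) ^ (-(γ + 1)) * ((2 * β * |b|) ^ (-(γ + 1)) *
      (1 / (4 * α * b ^ 2) + 1 / (4 * β * b ^ 2)) ^ (-(γ + 1))) := by
    rw [← mul_rpow (by positivity) (by positivity), ← mul_rpow (by positivity) (by positivity),
      ← sq_abs b]
    congr 1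
    field_simp
    ring
  rw [key]
  congr 1
  ring

theorem inner_gaussianLp_hankelGaussianLp {γ b : ℝ} (hγ : -1 < γ) (hb : b ≠ 0)
    (α β : Set.Ioi (0 : ℝ)) : inner ℂ (gaussianLp hγ α) (hankelGaussianLp hγ hb β) =
      inner ℂ (hankelGaussianLp hγ hb α) (gaussianLp hγ β) := by
  have hα : (0 : ℝ) < α := α.2
  have hβ : (0 : ℝ) < β := β.2
  have hb' : 0 < |b| := abs_pos.2 hb
  simp only [hankelGaussianLp, inner_smul_left, inner_smul_right, Complex.conj_ofReal,
    inner_gaussianLp_gaussianLp, ← Complex.ofReal_mul, dualIndex]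
  rw [mul_left_comm, mul_left_comm (_ ^ _) (_ / _ : ℝ), ← mul_rpow (by positivity) (by positivity),
    ← mul_rpow (by positivity) (by positivity), ← sq_abs b]
  congr 3
  field_simp
  ring

/-- Plancherel for the Hankel transform. -/
theorem hankel_plancherel {γ b : ℝ} (hγ : -(1 / 2) ≤ γ) (hb : b ≠ 0) {f : ℝ → ℂ}
    (h1 : MemLp f 1 (weightedMeasure γ)) (h2 : MemLp f 2 (weightedMeasure γ)) :
    MemLp (hankel γ b f) 2 (weightedMeasure γ) ∧
      eLpNorm (hankel γ b f) 2 (weightedMeasure γ) = eLpNorm f 2 (weightedMeasure γ) := by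
  have hγ1 : -1 < γ := by linarith
  have hf := memLp_one_iff_integrable.1 h1
  obtain ⟨F, hF, hFi⟩ := exists_isometric_image (orthogonal_span_gaussianLp hγ1)
    (inner_hankelGaussianLp_hankelGaussianLp hγ1 hb) (inner_gaussianLp_hankelGaussianLp hγ1 hb)
    (h2.toLp f)
  have hF2 (α : ℝ) (hα : 0 < α) :
      Integrable (fun t => (exp (-α * t ^ 2) : ℂ) * F t) (weightedMeasure γ) :=
    (memLp_gaussian hγ1 hα).integrable_mul (Lp.memLp F)
  have hH2 (α : ℝ) (hα : 0 < α) :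
      Integrable (fun t => (exp (-α * t ^ 2) : ℂ) * hankel γ b f t) (weightedMeasure γ) :=
    (integrable_gaussian hγ1 hα).ofReal.mul_bdd (aestronglyMeasurable_hankel hγ1 b hf)
      (Filter.Eventually.of_forall (norm_hankel_le hγ b hf))
  have hae : hankel γ b f =ᵐ[weightedMeasure γ] F := by
    have : (fun t => hankel γ b f t - F t) =ᵐ[weightedMeasure γ] 0 := by
      refine ae_eq_zero_of_integral_gaussian_eq_zero_complex (ae_weightedMeasure_pos γ) ?_ ?_
      · intro α hα
        simp only [mul_sub]
        exact (hH2 α hα).sub (hF2 α hα)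
      · intro α hα
        simp only [mul_sub]
        rw [integral_sub (hH2 α hα) (hF2 α hα), sub_eq_zero,
          integral_gaussian_mul_hankel hγ hb ⟨α, hα⟩ hf]
        have := hFi ⟨α, hα⟩
        rw [inner_gaussianLp, inner_hankelGaussianLp] at this
        rw [this]
        refine integral_congr_ae ?_
        filter_upwards [h2.coeFn_toLp] with s hs
        rw [hs]
    filter_upwards [this] with t ht
    exact sub_eq_zero.1 ht
  refine ⟨(memLp_congr_ae hae).2 (Lp.memLp F), ?_⟩
  rw [eLpNorm_congr_ae hae, ← Lp.enorm_def, ← ofReal_norm, hF, ofReal_norm, Lp.enorm_def,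
    eLpNorm_congr_ae h2.coeFn_toLp]

/-- The quadratic-phase transform is, up to unimodular factors, a Hankel transform. -/
theorem transform_eq_phase_mul_hankel (a b c d e γ : ℝ) (hb : b ≠ 0) (h : ℝ → ℂ) (t : ℝ) :
    transform a b c d e γ h t =
      ((|b| ^ (γ + 1) : ℝ) : ℂ) / (Complex.I * (b : ℂ)) ^ ((γ : ℂ) + 1) *
        Complex.exp (((-(c * t ^ 2 + e * t) : ℝ) : ℂ) * Complex.I) *
        hankel γ b
          (fun s => Complex.exp (((-(a * s ^ 2 + d * s) : ℝ) : ℂ) * Complex.I) * h s) t := by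
  have hb' : ((|b| ^ (γ + 1) : ℝ) : ℂ) ≠ 0 :=
    Complex.ofReal_ne_zero.2 (rpow_pos_of_pos (abs_pos.2 hb) _).ne'
  have e1 : ∫ s in Set.Ioi (0 : ℝ), kernel a b c d e γ t s * h s * ((s ^ (2 * γ + 1) : ℝ) : ℂ) =
      Complex.exp (((-(c * t ^ 2 + e * t) : ℝ) : ℂ) * Complex.I) *
        ∫ s, (normalizedBessel γ (s * t / b) : ℂ) *
          (Complex.exp (((-(a * s ^ 2 + d * s) : ℝ) : ℂ) * Complex.I) * h s) ∂weightedMeasure γ := by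
    rw [← integral_const_mul, integral_weightedMeasure]
    refine integral_congr_ae (Filter.Eventually.of_forall fun s => ?_)
    simp only [kernel, Complex.real_smul]
    rw [show -Complex.I * ((a * s ^ 2 + c * t ^ 2 + d * s + e * t : ℝ) : ℂ) =
      ((-(c * t ^ 2 + e * t) : ℝ) : ℂ) * Complex.I + ((-(a * s ^ 2 + d * s) : ℝ) : ℂ) * Complex.I by
        push_cast; ring, Complex.exp_add]
    ring
  rw [transform, e1, hankel, Complex.ofReal_div]
  generalize (∫ s, (_ : ℂ) ∂weightedMeasure γ) = J
  field_simp

end QPFB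

theorem mainTheorem4 (a b c d e γ : ℝ) (hb : b ≠ 0) (hγ : -(1 / 2) ≤ γ) (h : ℝ → ℂ)
    (h1 : MemLp h 1 (QPFB.weightedMeasure γ)) (h2 : MemLp h 2 (QPFB.weightedMeasure γ)) :
    MemLp (QPFB.transform a b c d e γ h) 2 (QPFB.weightedMeasure γ) ∧
      eLpNorm (QPFB.transform a b c d e γ h) 2 (QPFB.weightedMeasure γ) =
        eLpNorm h 2 (QPFB.weightedMeasure γ) := by
  set f : ℝ → ℂ := fun s => Complex.exp (((-(a * s ^ 2 + d * s) : ℝ) : ℂ) * Complex.I) * h s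
  have hnorm (s : ℝ) : ‖f s‖ = ‖h s‖ := by
    simp only [f]
    rw [norm_mul, Complex.norm_exp_ofReal_mul_I, one_mul]
  have hfm : AEStronglyMeasurable f (QPFB.weightedMeasure γ) :=
    (Continuous.aestronglyMeasurable (by fun_prop)).mul h1.aestronglyMeasurable
  obtain ⟨hH, hHn⟩ := QPFB.hankel_plancherel hγ hb
    ((memLp_congr_norm hfm h1.aestronglyMeasurable (Filter.Eventually.of_forall hnorm)).2 h1)
    ((memLp_congr_norm hfm h1.aestronglyMeasurable (Filter.Eventually.of_forall hnorm)).2 h2)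
  have hIb : Complex.I * (b : ℂ) ≠ 0 := mul_ne_zero Complex.I_ne_zero (Complex.ofReal_ne_zero.2 hb)
  have hb' : 0 < |b| ^ (γ + 1) := Real.rpow_pos_of_pos (abs_pos.2 hb) _
  have hT := funext (QPFB.transform_eq_phase_mul_hankel a b c d e γ hb h)
  have hTn (t : ℝ) : ‖QPFB.transform a b c d e γ h t‖ = ‖QPFB.hankel γ b f t‖ := by
    rw [hT, norm_mul, norm_mul, norm_div, Complex.norm_exp_ofReal_mul_I,
      Complex.norm_cpow_of_ne_zero hIb, Complex.norm_real, Real.norm_of_nonneg hb'.le]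
    simp [div_self hb'.ne', f]
  have hTm : AEStronglyMeasurable (QPFB.transform a b c d e γ h) (QPFB.weightedMeasure γ) := by
    rw [hT]
    exact (Continuous.aestronglyMeasurable (by fun_prop)).mul hH.aestronglyMeasurable
  refine ⟨(memLp_congr_norm hTm hH.aestronglyMeasurable (Filter.Eventually.of_forall hTn)).2 hH, ?_⟩
  rw [eLpNorm_congr_norm_ae (Filter.Eventually.of_forall hTn), hHn,
    eLpNorm_congr_norm_ae (Filter.Eventually.of_forall hnorm)]
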